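/- Let $R$ be a commutative ring with unit, let $A$ be an associative (not necessarily unital) $R$-algebra generated by $l$ elements $a_1,\dots,a_l$ ($l \ge 0$), and suppose that $A$ satisfies an admissible polynomial identity of degree $n\ge 1$, i.e. an identity $f(x_0,x_1,\dots)=0$, where $f$ is a noncommutative polynomial over $R$ of total degree at most $n$ and some coefficient of $f$ at a monomial of degree exactly $n$ is invertible (after scaling, equal to $1$). Let $Y$ be the set of all non-empty words of length $<n$ in $a_1,\dots,a_l$, and put $$\Phi(n,l)=8(l+1)^{n+1}n^6 .$$ The height of $A$ over $Y$ is the least $h$ such that every word in $a_1,\dots,a_l$ equals in $A$ an $R$-linear combination of products $u_1^{k_1}\cdots u_r^{k_r}$ with $r\le h$, $u_i\in Y$, $k_i\ge 1$ (it is $\infty$ if there is no such $h$). The essential height of $A$ over $Y$ is the least $h$ for which there is a finite set $D\subset A$ such that every element of $A$ is an $R$-linear combination of products $t_1\cdots t_m$ with $m\le 2h+1$, where each $t_i$ is an element of $D$ or has the form $y^{k}$ with $y\in Y$, $k\ge 1$, and at most $h$ of the indices $i$ satisfy $t_i\notin D$ (it is $\infty$ if there is no such $h$). Then the height of $A$ over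 $Y$ is finite and less than $\Phi(n,l)$, and likewise the essential height of $A$ over $Y$ is less than $\Phi(n,l)$. -/

import Mathlib

/-- The value of the word `w` (a list of letters) in an associative, not necessarily unital,
`R`-algebra `A` when the letter `i` is replaced by `a i`. It is computed in the algebra
`Unitization R A`, which is `A` with an external unit adjoined, so that the empty word has a
value (namely `1`); the value of a non-empty word lies in `A`. -/
noncomputable def wordValue (R : Type*) {A ι : Type*} [CommRing R] [NonUnitalRing A]
    [Module R A] [IsScalarTower R A A] [SMulCommClass R A A]
    (a : ι → A) (w : List ι) : Unitization R A :=
  (w.map fun i => (a i : Unitization R A)).prod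

/-- The non-empty words of length `< n`. -/
def shortWords (ι : Type*) (n : ℕ) : Set (List ι) :=
  {w | w ≠ [] ∧ w.length < n}

/-- The noncommutative polynomial `f` vanishes identically on `A`. Polynomials are elements of
the free associative algebra on `x 0, x 1, …`, that is, of the monoid algebra of the free monoid.
Substituting elements of `A` gives an element of `Unitization R A` whose component along the
unit is the constant term of `f`. -/
def IsPolynomialIdentity (R A : Type*) [CommRing R] [NonUnitalRing A]
    [Module R A] [IsScalarTower R A A] [SMulCommClass R A A]
    (f : MonoidAlgebra R (FreeMonoid ℕ)) : Prop :=
  ∀ x : ℕ → A,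
    MonoidAlgebra.lift R (Unitization R A) (FreeMonoid ℕ)
      (FreeMonoid.lift fun i => (x i : Unitization R A)) f = 0

/-- `A` satisfies an admissible polynomial identity of degree `n`: an identity of total degree
at most `n`, one of whose coefficients at a monomial of degree exactly `n` is invertible
(after scaling: equal to `1`). -/
def HasAdmissibleIdentity (R A : Type*) [CommRing R] [NonUnitalRing A]
    [Module R A] [IsScalarTower R A A] [SMulCommClass R A A] (n : ℕ) : Prop :=
  ∃ f : MonoidAlgebra R (FreeMonoid ℕ),
    (∀ w : FreeMonoid ℕ, f.coeff w ≠ 0 → w.length ≤ n) ∧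
    (∃ w : FreeMonoid ℕ, w.length = n ∧ IsUnit (f.coeff w)) ∧
    IsPolynomialIdentity R A f

/-- The values of the products `u₁ ^ k₁ * ⋯ * u_r ^ k_r` with `r ≤ h`, all `u_i ∈ Y` and all
`k_i ≥ 1`. -/
def powerProducts (R : Type*) {A ι : Type*} [CommRing R] [NonUnitalRing A]
    [Module R A] [IsScalarTower R A A] [SMulCommClass R A A]
    (a : ι → A) (Y : Set (List ι)) (h : ℕ) : Set (Unitization R A) :=
  {p | ∃ L : List (List ι × ℕ), L.length ≤ h ∧ (∀ q ∈ L, q.1 ∈ Y ∧ 0 < q.2) ∧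
    p = (L.map fun q => wordValue R a q.1 ^ q.2).prod}

/-- Every word in the generators is a linear combination of products of at most `h` powers of
words from `Y`. -/
def HeightAtMost (R : Type*) {A ι : Type*} [CommRing R] [NonUnitalRing A]
    [Module R A] [IsScalarTower R A A] [SMulCommClass R A A]
    (a : ι → A) (Y : Set (List ι)) (h : ℕ) : Prop :=
  ∀ w : List ι, w ≠ [] → wordValue R a w ∈ Submodule.span R (powerProducts R a Y h)

/-- The height over `Y` of the algebra generated by the `a i`: the least `h` such that every
word is a linear combination of products of at most `h` powers of words from `Y`
(`⊤` if there is none). -/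
noncomputable def height (R : Type*) {A ι : Type*} [CommRing R] [NonUnitalRing A]
    [Module R A] [IsScalarTower R A A] [SMulCommClass R A A]
    (a : ι → A) (Y : Set (List ι)) : ℕ∞ :=
  sInf {h : ℕ∞ | ∃ m : ℕ, h = m ∧ HeightAtMost R a Y m}

open Classical in
/-- The products `t₁ * ⋯ * t_m` with `m ≤ 2 * h + 1` in which every factor is an element of `D`
or a power of a word from `Y`, and at most `h` of the factors are not in `D`. -/
def essentialProducts (R : Type*) {A ι : Type*} [CommRing R] [NonUnitalRing A]
    [Module R A] [IsScalarTower R A A] [SMulCommClass R A A]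
    (a : ι → A) (Y : Set (List ι)) (D : Set A) (h : ℕ) : Set (Unitization R A) :=
  {p | ∃ L : List (Unitization R A), L.length ≤ 2 * h + 1 ∧
    (∀ t ∈ L, (∃ d ∈ D, t = (d : Unitization R A)) ∨
      ∃ u ∈ Y, ∃ k : ℕ, 0 < k ∧ t = wordValue R a u ^ k) ∧
    L.countP (fun t => ¬ ∃ d ∈ D, t = (d : Unitization R A)) ≤ h ∧
    p = L.prod}

/-- For some finite `D ⊆ A`, every element of `A` is a linear combination of the products
above. -/
def EssentialHeightAtMost (R : Type*) {A ι : Type*} [CommRing R] [NonUnitalRing A]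
    [Module R A] [IsScalarTower R A A] [SMulCommClass R A A]
    (a : ι → A) (Y : Set (List ι)) (h : ℕ) : Prop :=
  ∃ D : Set A, D.Finite ∧
    ∀ x : A, (x : Unitization R A) ∈ Submodule.span R (essentialProducts R a Y D h)

/-- The essential height over `Y` (`⊤` if there is no bound). -/
noncomputable def essentialHeight (R : Type*) {A ι : Type*} [CommRing R] [NonUnitalRing A]
    [Module R A] [IsScalarTower R A A] [SMulCommClass R A A]
    (a : ι → A) (Y : Set (List ι)) : ℕ∞ :=
  sInf {h : ℕ∞ | ∃ m : ℕ, h = m ∧ EssentialHeightAtMost R a Y m}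

/-! This is Shirshov's height argument. The identity can be made multilinear with coefficient 1 at
the identity permutation, so the value of an `n`-divisible word is a combination of values of
lexicographically smaller words of the same length (`IsDivisible.wordValue_mem_span`). Only words
that are not `n`-divisible need to be treated.

Cut such a word from the left, closing a segment as soon as its first `n` suffixes become
incomparable. Before its last letter a segment has two comparable suffixes, hence a period less than
`n` after fewer than `n` letters, so it is a product of at most `n` powers of short words. Each
segment also ends in a break word, of length at most `3 * n + 1` (`exists_breakWord_suffix`);
periodicity leaves few break words. If one of them, `G`, ends `n` segments, cutting at the largest
of the first `n` suffixes of `G` in its first occurrence, at the second largest in the next, and so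
on, exhibits `n`-divisibility. So the number of segments is bounded, and with it the height. The
essential height is handled with `D = ∅`. -/

/-- No two of the first `n` suffixes of `w` are such that the shorter is a prefix of the longer. -/
def SuffixesIncomparable {α : Type*} (n : ℕ) (w : List α) : Prop :=
  ∀ i j, i < j → j < n → ¬ w.drop j <+: w.drop i

/-- `w` is a product of at most `h` powers of words from `Y`. -/
def IsPowerProduct {α : Type*} (Y : Set (List α)) (h : ℕ) (w : List α) : Prop :=
  ∃ L : List (List α × ℕ), L.length ≤ h ∧ (∀ q ∈ L, q.1 ∈ Y ∧ 0 < q.2) ∧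
    w = (L.map fun q => (List.replicate q.2 q.1).flatten).flatten

/-- Lexicographic comparison decided by a letter present in both words. -/
def StableLT {α : Type*} [LT α] (u v : List α) : Prop := ∀ x y, u ++ x < v ++ y

/-- The word `w` can be cut so that any nontrivial permutation of `n` consecutive non-empty
factors makes it lexicographically smaller. -/
def IsDivisible {α : Type*} [LT α] (n : ℕ) (w : List α) : Prop :=
  ∃ (u : List α) (V : List (List α)) (t : List α), V.length = n ∧ (∀ v ∈ V, v ≠ []) ∧
    V.Pairwise (fun v v' => StableLT v' v) ∧ w = u ++ V.flatten ++ t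

/-! ### Comparable suffixes as periodicity -/

theorem List.drop_prefix_drop_iff {α : Type*} (w : List α) (i j : ℕ) :
    w.drop j <+: w.drop i ↔ ∀ t, j + t < w.length → w[j + t]? = w[i + t]? := by
  rw [List.prefix_iff_getElem?]
  simp only [List.getElem?_drop, List.getElem_drop, List.length_drop]
  constructor
  · intro h t ht
    rw [h t (by omega), List.getElem?_eq_getElem ht]
  · intro h t ht
    rw [← h t (by omega), List.getElem?_eq_getElem]

theorem not_suffixesIncomparable_iff {α : Type*} {n : ℕ} {w : List α} :
    ¬ SuffixesIncomparable n w ↔ ∃ i d, 0 < d ∧ i + d < n ∧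
      ∀ t, i + d + t < w.length → w[i + d + t]? = w[i + t]? := by
  simp only [SuffixesIncomparable, List.drop_prefix_drop_iff]
  push Not
  constructor
  · rintro ⟨i, j, hij, hj, h⟩
    exact ⟨i, j - i, by omega, by omega, by rwa [Nat.add_sub_cancel' hij.le]⟩
  · rintro ⟨i, d, hd, hn, h⟩
    exact ⟨i, i + d, by omega, hn, h⟩

/-- In a shorter word the last of the `n` suffixes is empty, hence a prefix of the first. -/
theorem SuffixesIncomparable.le_length {α : Type*} {n : ℕ} (hn : 2 ≤ n) {w : List α}
    (h : SuffixesIncomparable n w) : n ≤ w.length := by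
  by_contra hlt
  refine h 0 (n - 1) (by omega) (by omega) ?_
  rw [List.drop_eq_nil_of_le (by omega)]
  exact List.nil_prefix

/-! ### Products of powers -/

theorem IsPowerProduct.append {α : Type*} {Y : Set (List α)} {h k : ℕ} {u v : List α}
    (hu : IsPowerProduct Y h u) (hv : IsPowerProduct Y k v) :
    IsPowerProduct Y (h + k) (u ++ v) := by
  obtain ⟨L, hL, hY, rfl⟩ := hu
  obtain ⟨M, hM, hY', rfl⟩ := hv
  refine ⟨L ++ M, by simp; omega, ?_, by simp⟩
  intro q hq
  rcases List.mem_append.1 hq with hq | hq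
  exacts [hY q hq, hY' q hq]

theorem IsPowerProduct.mono {α : Type*} {Y : Set (List α)} {h k : ℕ} {u : List α}
    (hu : IsPowerProduct Y h u) (hk : h ≤ k) : IsPowerProduct Y k u := by
  obtain ⟨L, hL, hY, rfl⟩ := hu
  exact ⟨L, hL.trans hk, hY, rfl⟩

theorem IsPowerProduct.letters {α : Type*} {n : ℕ} (hn : 2 ≤ n) (w : List α) :
    IsPowerProduct (shortWords α n) w.length w := by
  refine ⟨w.map fun x => ([x], 1), by simp, ?_, ?_⟩
  · intro q hq
    obtain ⟨x, -, rfl⟩ := List.mem_map.1 hq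
    exact ⟨⟨by simp, by simp; omega⟩, one_pos⟩
  · induction w with
    | nil => simp
    | cons x w ih => simpa using ih

theorem IsPowerProduct.flatten {α : Type*} {Y : Set (List α)} {h : ℕ} {ps : List (List α)}
    (hp : ∀ p ∈ ps, IsPowerProduct Y h p) : IsPowerProduct Y (ps.length * h) ps.flatten := by
  induction ps with
  | nil => exact ⟨[], by simp, by simp, by simp⟩
  | cons p ps ih =>
    have := (hp p (by simp)).append (ih fun q hq => hp q (by simp [hq]))
    simpa [Nat.add_mul, Nat.add_comm] using this

/-- The hypothesis says that `z` has period `u.length` and starts like `u`; peel off copies of `u`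
while they fit. -/
theorem List.exists_replicate_of_prefix_append {α : Type*} {u : List α} (hu : u ≠ []) :
    ∀ z : List α, z <+: u ++ z →
      ∃ k r, z = (List.replicate k u).flatten ++ r ∧ r.length < u.length := by
  intro z
  induction hz : z.length using Nat.strong_induction_on generalizing z with
  | _ m ih =>
    intro h
    rcases Nat.lt_or_ge z.length u.length with hlt | hge
    · exact ⟨0, z, by simp, hlt⟩
    · obtain ⟨z', rfl⟩ := List.prefix_of_prefix_length_le (List.prefix_append u z) h hge
      rw [List.prefix_append_right_inj] at h
      have := List.length_pos_iff.2 hu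
      obtain ⟨k, r, e, hr⟩ := ih z'.length (by simp at hz; omega) z' rfl h
      refine ⟨k + 1, r, ?_, hr⟩
      rw [List.replicate_succ, List.flatten_cons, List.append_assoc, ← e]

/-- If suffix `j` is a prefix of suffix `i`, the word has period `j - i` from position `i` on: `i`
single letters, one power, and a tail of fewer than `j - i` letters, so at most `j < n` factors. -/
theorem isPowerProduct_of_not_suffixesIncomparable {α : Type*} {n : ℕ} (hn : 2 ≤ n)
    {w : List α} (h : ¬ SuffixesIncomparable n w) :
    IsPowerProduct (shortWords α n) n w := by
  simp only [SuffixesIncomparable] at h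
  push Not at h
  obtain ⟨i, j, hij, hj, hp⟩ := h
  rcases Nat.lt_or_ge w.length n with hlt | hge
  · exact (IsPowerProduct.letters hn w).mono hlt.le
  set z := w.drop i with hz
  have hd : w.drop j = z.drop (j - i) := by
    rw [hz, List.drop_drop]; congr 1; omega
  have hul : (z.take (j - i)).length = j - i := by
    rw [List.length_take, hz, List.length_drop]; omega
  have hu : z.take (j - i) ≠ [] := by
    rw [← List.length_pos_iff, hul]; omega
  have hpz : z <+: z.take (j - i) ++ z := by
    conv_lhs => rw [← List.take_append_drop (j - i) z]
    rw [List.prefix_append_right_inj, ← hd]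
    exact hp
  obtain ⟨k, r, e, hr⟩ := List.exists_replicate_of_prefix_append hu z hpz
  have hw : w = w.take i ++ ((List.replicate k (z.take (j - i))).flatten ++ r) := by
    rw [← e, hz, List.take_append_drop]
  rw [hw]
  have h1 := IsPowerProduct.letters hn (w.take i)
  have h3 := IsPowerProduct.letters hn r
  have h2 : IsPowerProduct (shortWords α n) 1 (List.replicate k (z.take (j - i))).flatten := by
    -- Exponents must be positive, so `k = 0` is the empty product.
    rcases Nat.eq_zero_or_pos k with rfl | hk
    · exact ⟨[], by simp, by simp, by simp⟩
    · refine ⟨[(z.take (j - i), k)], by simp, ?_, by simp⟩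
      intro q hq
      rw [List.mem_singleton] at hq
      subst hq
      exact ⟨⟨hu, by change (z.take (j - i)).length < n; omega⟩, hk⟩
  refine (h1.append (h2.append h3)).mono ?_
  rw [hul] at hr
  rw [List.length_take]
  omega

/-! ### Segmentation -/

theorem exists_segmentation {α : Type*} {n : ℕ} (hn : 2 ≤ n) (w : List α) :
    ∃ (ps : List (List α)) (t : List α), w = ps.flatten ++ t ∧ ¬ SuffixesIncomparable n t ∧
      ∀ p ∈ ps, SuffixesIncomparable n p ∧ ∃ P x, p = P ++ [x] ∧ ¬ SuffixesIncomparable n P := by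
  have hnil : ¬ SuffixesIncomparable n ([] : List α) := fun h => by
    have := h.le_length hn
    simp at this
    omega
  induction w using List.reverseRecOn with
  | nil => exact ⟨[], [], by simp, hnil, by simp⟩
  | append_singleton w x ih =>
    obtain ⟨ps, t, rfl, ht, hps⟩ := ih
    by_cases h : SuffixesIncomparable n (t ++ [x])
    · refine ⟨ps ++ [t ++ [x]], [], by simp, hnil, ?_⟩
      intro p hp
      rcases List.mem_append.1 hp with hp | hp
      · exact hps p hp
      · rw [List.mem_singleton] at hp
        subst hp
        exact ⟨h, t, x, rfl, ht⟩
    · exact ⟨ps, t ++ [x], by simp, h, hps⟩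

/-- Words with incomparable suffixes obtained by appending one letter to a word of length at most
`3 * n` without that property. -/
def breakWords (α : Type*) (n : ℕ) : Set (List α) :=
  {G | SuffixesIncomparable n G ∧ ∃ Q x, G = Q ++ [x] ∧ ¬ SuffixesIncomparable n Q ∧
    Q.length ≤ 3 * n}

/-- For long `P`, the last `2 * n` letters followed by `x` suffice: if this shorter word still had a
small period `e`, that period would force `x` to continue the old period `d` of `P`. -/
theorem exists_breakWord_suffix {α : Type*} {n : ℕ} {P : List α} {x : α}
    (hP : ¬ SuffixesIncomparable n P) (hG : SuffixesIncomparable n (P ++ [x])) :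
    ∃ G ∈ breakWords α n, G <:+ P ++ [x] := by
  rcases Nat.lt_or_ge (3 * n) P.length with hlt | hle
  swap
  · exact ⟨P ++ [x], ⟨hG, P, x, rfl, hP, hle⟩, List.suffix_refl _⟩
  obtain ⟨i, d, hd, hid, hper⟩ := not_suffixesIncomparable_iff.1 hP
  obtain ⟨U, Q, rfl, hQ⟩ : ∃ U Q, P = U ++ Q ∧ Q.length = 2 * n :=
    ⟨P.take (P.length - 2 * n), P.drop (P.length - 2 * n), by simp, by simp; omega⟩
  -- `U` covers the preperiod `i < n`, so `Q` lies wholly in the periodic part.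
  have hU : n < U.length := by simp at hlt; omega
  have hUQ : (U ++ Q).length = U.length + 2 * n := by simp [hQ]
  have hQx1 : (Q ++ [x]).length = 2 * n + 1 := by simp [hQ]
  have hQper : ∀ t, d + t < 2 * n → Q[d + t]? = Q[t]? := by
    intro t ht
    have := hper (U.length + t - i) (by simp; omega)
    rw [List.getElem?_append_right (by omega), List.getElem?_append_right (by omega)] at this
    convert this using 2 <;> omega
  have hQx : ∀ t, t < 2 * n → (Q ++ [x])[t]? = Q[t]? := fun t ht =>
    List.getElem?_append_left (by omega)
  refine ⟨Q ++ [x], ⟨?_, Q, x, rfl, ?_, by omega⟩, U, by simp⟩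
  · by_contra hbad
    obtain ⟨i', e, he, hie, hper'⟩ := not_suffixesIncomparable_iff.1 hbad
    refine not_suffixesIncomparable_iff.2 ⟨i, d, hd, hid, ?_⟩ hG
    intro t ht
    rcases Nat.lt_or_ge (i + d + t) (U ++ Q).length with h1 | h1
    · rw [List.getElem?_append_left (l₁ := U ++ Q) h1, List.getElem?_append_left (l₁ := U ++ Q) (by omega)]
      exact hper t h1
    · have ht' : i + d + t = U.length + 2 * n := by
        have : (U ++ Q ++ [x]).length = (U ++ Q).length + 1 := by
          rw [List.length_append, List.length_singleton]
        omega
      rw [ht', List.append_assoc, List.getElem?_append_right (l₁ := U) (by omega),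
        List.getElem?_append_right (l₁ := U) (by omega), Nat.add_sub_cancel_left]
      -- Go back from the last letter by `e`, then by `d`, then forward by `e`: the letter at
      -- distance `d` from the end is reached. The length `2 * n` exceeds `i' + e + d`, so all
      -- positions stay in range.
      have e1 := hper' (2 * n - e - i') (by omega)
      have e2 := hper' (2 * n - d - e - i') (by omega)
      have e3 := hQper (2 * n - e - d) (by omega)
      rw [show i' + e + (2 * n - e - i') = 2 * n by omega,
        show i' + (2 * n - e - i') = 2 * n - e by omega] at e1
      rw [show i' + e + (2 * n - d - e - i') = 2 * n - d by omega,
        show i' + (2 * n - d - e - i') = 2 * n - e - d by omega] at e2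
      rw [show d + (2 * n - e - d) = 2 * n - e by omega] at e3
      rw [e1, hQx _ (by omega), e3, ← hQx _ (by omega), ← e2]
      congr 1
      omega
  · exact not_suffixesIncomparable_iff.2 ⟨0, d, hd, by omega, fun t ht => by
      simpa using hQper t (by omega)⟩

/-! ### Counting the break words -/

/-- Reduces a position in a word with period `d` from position `i` on to one of the first `i + d`
positions. -/
def reducePos (i d t : ℕ) : ℕ := if t < i then t else i + (t - i) % d

theorem getElem?_reducePos {α : Type*} {P : List α} {i d : ℕ}
    (hper : ∀ t, i + d + t < P.length → P[i + d + t]? = P[i + t]?) (t : ℕ)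
    (ht : t < P.length) : P[t]? = P[reducePos i d t]? := by
  unfold reducePos
  split_ifs with h
  · rfl
  have key : ∀ q s, i + s + q * d < P.length → P[i + s + q * d]? = P[i + s]? := by
    intro q
    induction q with
    | zero => intro s _; simp
    | succ q ih =>
      intro s hs
      have e : i + s + (q + 1) * d = i + d + (s + q * d) := by ring
      rw [e] at hs ⊢
      rw [hper _ hs, ← ih s (by omega)]
      congr 1
      omega
  have e : t = i + (t - i) % d + (t - i) / d * d := by
    have := Nat.mod_add_div' (t - i) d
    omega
  conv_lhs => rw [e]
  exact key _ _ (e ▸ ht)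

/-- A break word `Q ++ [x]` is determined by the length of `Q`, the preperiod `i`, the period `d`,
the first `n` letters of `Q` and `x`, since `i + d < n`. -/
theorem breakWords_finite_card {α : Type*} [Fintype α] (n : ℕ) :
    (breakWords α n).Finite ∧
      (breakWords α n).ncard ≤ (3 * n + 1) * n * n * Fintype.card α ^ (n + 1) := by
  classical
  let T := (Fin (3 * n + 1) × Fin n × Fin n) × (Fin n → α) × α
  let F : T → List α := fun q =>
    List.ofFn (fun t : Fin q.1.1 => if h : reducePos q.1.2.1 q.1.2.2 t < n then
      q.2.1 ⟨reducePos q.1.2.1 q.1.2.2 t, h⟩ else q.2.2) ++ [q.2.2]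
  have hsub : breakWords α n ⊆ Set.range F := by
    rintro G ⟨-, Q, x, rfl, hQ, hlen⟩
    obtain ⟨i, d, hd, hid, hper⟩ := not_suffixesIncomparable_iff.1 hQ
    refine ⟨((⟨Q.length, by omega⟩, ⟨i, by omega⟩, ⟨d, by omega⟩),
      -- If `Q` has fewer than `n` letters, the table is padded with `x`; the padding is never read.
      (fun t => (Q[(t : ℕ)]?).getD x), x), ?_⟩
    simp only [F, List.append_left_inj]
    apply List.ext_getElem (by simp)
    intro t h1 h2
    have hr : reducePos i d t < n := by
      unfold reducePos
      have := Nat.mod_lt (t - i) hd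
      split_ifs <;> omega
    have := getElem?_reducePos hper t h2
    simp [hr, ← this, h2]
  refine ⟨(Set.finite_range F).subset hsub, ?_⟩
  calc (breakWords α n).ncard ≤ (Set.range F).ncard := Set.ncard_le_ncard hsub (Set.finite_range F)
    _ ≤ Nat.card T := by
      rw [← Set.image_univ, ← Set.ncard_univ]
      exact Set.ncard_image_le (Set.finite_univ)
    _ = _ := by
      simp [T, Nat.card_eq_fintype_card]
      ring

/-! ### Divisibility -/

theorem StableLT.append {α : Type*} [LT α] {u v : List α} (h : StableLT u v) (x y : List α) :
    StableLT (u ++ x) (v ++ y) := fun x' y' => by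
  simpa using h (x ++ x') (y ++ y')

theorem stableLT_of_lt_of_not_prefix {α : Type*} [LinearOrder α] :
    ∀ {u v : List α}, u < v → ¬ u <+: v → StableLT u v
  | [], _, _, hp => (hp List.nil_prefix).elim
  | a :: u, [], h, _ => (List.not_lt_nil _ h).elim
  | a :: u, b :: v, h, hp => fun x y => by
    rcases List.cons_lt_cons_iff.1 h with h' | ⟨hab, h'⟩
    · exact List.cons_lt_cons_iff.2 (Or.inl h')
    · exact List.cons_lt_cons_iff.2 (Or.inr ⟨hab, stableLT_of_lt_of_not_prefix h'
        (fun hp' => hp (hab ▸ (List.prefix_cons_inj a).2 hp')) x y⟩)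

/-- At the first place where the lists differ, `V'` has a factor that comes later in `V`, hence a
stably smaller one, which decides the comparison. -/
theorem flatten_append_lt_of_perm {α : Type*} [LinearOrder α] {V : List (List α)} :
    ∀ {V' : List (List α)}, V.Pairwise (fun v v' => StableLT v' v) → V'.Perm V → V' ≠ V →
      ∀ t, V'.flatten ++ t < V.flatten ++ t := by
  induction V with
  | nil => intro V' _ hp hne; exact (hne hp.eq_nil).elim
  | cons v V ih =>
    intro V' hV hp hne t
    rw [List.pairwise_cons] at hV
    cases V' with
    | nil => exact absurd hp.symm.eq_nil (by simp)
    | cons v' V' =>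
      simp only [List.flatten_cons, List.append_assoc]
      by_cases hvv : v' = v
      · subst hvv
        exact List.append_left_lt (ih hV.2 hp.cons_inv (fun h => hne (by rw [h])) t)
      · have : v' ∈ V := by
          have := hp.subset (List.mem_cons_self (a := v') (l := V'))
          simpa [hvv] using this
        exact hV.1 v' this _ _

/-- Each new occurrence of `G` is cut at the next suffix in `S`; a factor runs from its cut to the
following one, and the last to the end. -/
theorem exists_factors_of_suffixes {α : Type*} [BEq (List α)] [LawfulBEq (List α)]
    (c : List α → List α) (G : List α) :
    ∀ (ps : List (List α)), (∀ p ∈ ps, c p <:+ p) → ∀ (S : List (List α)), (∀ s ∈ S, s <:+ G) →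
      S.length ≤ (ps.map c).count G →
      ∃ (u : List α) (V : List (List α)), ps.flatten = u ++ V.flatten ∧
        List.Forall₂ (fun s v => s <+: v) S V := by
  intro ps
  induction ps with
  | nil =>
    intro _ S _ hS
    have : S = [] := by simpa using hS
    subst this
    exact ⟨[], [], by simp, List.Forall₂.nil⟩
  | cons p ps ih =>
    intro hc S hSG hS
    have hc' : ∀ q ∈ ps, c q <:+ q := fun q hq => hc q (by simp [hq])
    rw [List.map_cons, List.count_cons] at hS
    by_cases hp : c p = G
    · cases S with
      | nil => exact ⟨(p :: ps).flatten, [], by simp, List.Forall₂.nil⟩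
      | cons s S =>
        obtain ⟨u, V, e, hV⟩ := ih hc' S (fun s' hs' => hSG s' (by simp [hs']))
          (by simp [hp] at hS; exact hS)
        obtain ⟨q, hq⟩ := hc p (by simp)
        obtain ⟨r, hr⟩ := hSG s (by simp)
        refine ⟨q ++ r, (s ++ u) :: V, ?_, List.Forall₂.cons (List.prefix_append _ _) hV⟩
        rw [List.flatten_cons, e, ← hq, hp, ← hr]
        simp
    · obtain ⟨u, V, e, hV⟩ := ih hc' S hSG (by simpa [hp] using hS)
      exact ⟨p ++ u, V, by simp [e], hV⟩

theorem exists_sorted_suffixes {α : Type*} [LinearOrder α] {n : ℕ} (hn : 2 ≤ n) {G : List α}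
    (hG : SuffixesIncomparable n G) :
    ∃ S : List (List α), S.length = n ∧ (∀ s ∈ S, s <:+ G ∧ s ≠ []) ∧
      S.Pairwise (fun s s' => StableLT s' s) := by
  classical
  have hlen := hG.le_length hn
  let F := (Finset.range n).image fun i => G.drop i
  have hcard : F.card = n := by
    rw [Finset.card_image_of_injOn, Finset.card_range]
    intro i hi j hj hij
    have := congrArg List.length hij
    simp at hi hj this
    omega
  have hmem : ∀ s ∈ F.sort (· ≥ ·), ∃ i < n, s = G.drop i := by
    intro s hs
    obtain ⟨i, hi, rfl⟩ := Finset.mem_image.1 ((Finset.mem_sort _).1 hs)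
    exact ⟨i, Finset.mem_range.1 hi, rfl⟩
  refine ⟨F.sort (· ≥ ·), by rw [Finset.length_sort, hcard], ?_, ?_⟩
  · intro s hs
    obtain ⟨i, hi, rfl⟩ := hmem s hs
    refine ⟨List.drop_suffix i G, ?_⟩
    rw [← List.length_pos_iff, List.length_drop]
    omega
  · refine (Finset.sortedGT_sort F).pairwise.imp_of_mem ?_
    intro s s' hs hs' hlt
    obtain ⟨i, hi, rfl⟩ := hmem s hs
    obtain ⟨j, hj, rfl⟩ := hmem s' hs'
    refine stableLT_of_lt_of_not_prefix hlt fun hp => ?_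
    -- A shorter suffix is no prefix of a longer one by incomparability, and a longer one is no
    -- prefix of a shorter one by length.
    rcases lt_trichotomy i j with h | h | h
    · exact hG i j h hj hp
    · subst h; exact lt_irrefl _ hlt
    · have := hp.length_le
      simp at this
      omega

theorem isDivisible_of_count {α : Type*} [LinearOrder α] [B : BEq (List α)]
    [LawfulBEq (List α)] {n : ℕ} (hn : 2 ≤ n)
    {c : List α → List α} {ps : List (List α)} (hc : ∀ p ∈ ps, c p <:+ p) {G : List α}
    (hG : SuffixesIncomparable n G) (hcount : n ≤ (ps.map c).count G) (t : List α) :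
    IsDivisible n (ps.flatten ++ t) := by
  obtain ⟨S, hSn, hS, hSp⟩ := exists_sorted_suffixes hn hG
  obtain ⟨u, V, e, hV⟩ := exists_factors_of_suffixes c G ps hc S (fun s hs => (hS s hs).1)
    (hSn.trans_le hcount)
  refine ⟨u, V, t, hV.length_eq ▸ hSn, ?_, ?_, by rw [e]⟩
  · clear e hSn hSp
    induction hV with
    | nil => simp
    | cons h _ ih =>
      intro v hv
      rcases List.mem_cons.1 hv with rfl | hv
      · rintro rfl
        exact (hS _ (by simp)).2 (List.prefix_nil.1 h)
      · exact ih (fun s hs => hS s (by simp [hs])) v hv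
  · clear e hSn hS
    induction hV with
    | nil => exact List.Pairwise.nil
    | @cons s v S V h hSV ih =>
      rw [List.pairwise_cons] at hSp ⊢
      refine ⟨fun v' hv' => ?_, ih hSp.2⟩
      obtain ⟨i, hi, rfl⟩ := List.mem_iff_getElem.1 hv'
      have hi' : i < S.length := hSV.length_eq ▸ hi
      obtain ⟨x, rfl⟩ := h
      obtain ⟨y, hy⟩ := (List.forall₂_iff_get.1 hSV).2 i hi' hi
      change S[i] ++ y = V[i] at hy
      rw [← hy]
      exact (hSp.1 _ (List.getElem_mem hi')).append y x

/-- The bound is the number of break words, times `n - 1` segments ending in each, times `n + 1`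
powers per segment, plus `n` for the unfinished remainder. -/
theorem isDivisible_or_isPowerProduct {α : Type*} [LinearOrder α] [Fintype α] {n : ℕ}
    (hn : 2 ≤ n) (w : List α) :
    IsDivisible n w ∨ IsPowerProduct (shortWords α n)
      ((3 * n + 1) * n * n * Fintype.card α ^ (n + 1) * (n - 1) * (n + 1) + n) w := by
  classical
  refine or_iff_not_imp_left.2 fun hdiv => ?_
  obtain ⟨ps, t, rfl, ht, hps⟩ := exists_segmentation hn w
  have hex : ∀ p, ∃ G, p ∈ ps → G ∈ breakWords α n ∧ G <:+ p := by
    intro p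
    by_cases hp : p ∈ ps
    · obtain ⟨hgood, P, x, rfl, hP⟩ := hps p hp
      obtain ⟨G, h1, h2⟩ := exists_breakWord_suffix hP hgood
      exact ⟨G, fun _ => ⟨h1, h2⟩⟩
    · exact ⟨[], fun h => (hp h).elim⟩
  choose c hc using hex
  obtain ⟨hfin, hcard⟩ := breakWords_finite_card (α := α) n
  have hlen : ps.length ≤ (3 * n + 1) * n * n * Fintype.card α ^ (n + 1) * (n - 1) := by
    rw [← List.length_map c, ← List.sum_toFinset_count_eq_length]
    refine (Finset.sum_le_card_nsmul _ _ (n - 1) fun G hG => ?_).trans ?_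
    · by_contra hlt
      obtain ⟨p, hp, rfl⟩ := List.mem_map.1 (List.mem_toFinset.1 hG)
      exact hdiv (isDivisible_of_count (B := instBEqOfDecidableEq) hn (fun p hp => (hc p hp).2)
        (hc p hp).1.1 (by omega) t)
    · rw [smul_eq_mul]
      refine Nat.mul_le_mul_right _ (le_trans ?_ hcard)
      rw [← Set.ncard_coe_finset]
      refine Set.ncard_le_ncard ?_ hfin
      intro G hG
      obtain ⟨p, hp, rfl⟩ := List.mem_map.1 (List.mem_toFinset.1 (Finset.mem_coe.1 hG))
      exact (hc p hp).1
  have hp : ∀ p ∈ ps, IsPowerProduct (shortWords α n) (n + 1) p := by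
    intro p hp
    obtain ⟨-, P, x, rfl, hP⟩ := hps p hp
    exact (isPowerProduct_of_not_suffixesIncomparable hn hP).append
      (IsPowerProduct.letters hn [x])
  exact ((IsPowerProduct.flatten hp).append
    (isPowerProduct_of_not_suffixesIncomparable hn ht)).mono
    (Nat.add_le_add_right (Nat.mul_le_mul_right _ hlen) _)

/-! ### Multilinearization of the identity -/

theorem sum_powerset_neg_one_pow_card_compl {R : Type*} [CommRing R] (n : ℕ) (I : Finset (Fin n)) :
    ∑ S : Finset (Fin n), (-1 : R) ^ Sᶜ.card * (if I ⊆ S then 1 else 0) =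
      if I = Finset.univ then 1 else 0 := by
  classical
  have h1 : ∑ S : Finset (Fin n), (-1 : R) ^ Sᶜ.card * (if I ⊆ S then 1 else 0) =
      ∑ S ∈ (Iᶜ).powerset, (-1 : R) ^ S.card := by
    rw [← Equiv.sum_comp (Equiv.mk compl compl compl_compl compl_compl :
      Finset (Fin n) ≃ Finset (Fin n))]
    simp only [Equiv.coe_fn_mk, compl_compl, mul_ite, mul_one, mul_zero]
    rw [← Finset.sum_filter]
    refine Finset.sum_congr ?_ fun _ _ => rfl
    ext S
    simp only [Finset.mem_filter, Finset.mem_univ, true_and, Finset.mem_powerset]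
    exact Finset.subset_compl_comm
  have h2 := congrArg (Int.cast : ℤ → R)
    (Finset.sum_powerset_neg_one_pow_card (x := Iᶜ))
  push_cast at h2
  rw [h1, h2]
  simp [Finset.compl_eq_empty_iff]

theorem prod_map_sum_ite {R B : Type*} [CommRing R] [Ring B] [Algebra R B] {n : ℕ}
    (g : Fin n → ℕ) (y : Fin n → B) (S : Finset (Fin n)) (m : List ℕ) :
    (m.map fun k => ∑ j, (if j ∈ S ∧ g j = k then (1 : R) else 0) • y j).prod =
      ∑ φ : Fin m.length → Fin n,
        ((if Finset.univ.image φ ⊆ S then 1 else 0) * if ∀ t, g (φ t) = m.get t then (1 : R) else 0) •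
          (List.ofFn fun t => y (φ t)).prod := by
  classical
  have h := MultilinearMap.map_sum (MultilinearMap.mkPiAlgebraFin R m.length B)
    (fun (t : Fin m.length) (j : Fin n) =>
      (if j ∈ S ∧ g j = m.get t then (1 : R) else 0) • y j)
  simp only [MultilinearMap.map_smul_univ, MultilinearMap.mkPiAlgebraFin_apply] at h
  have e : (m.map fun k => ∑ j, (if j ∈ S ∧ g j = k then (1 : R) else 0) • y j) =
      List.ofFn fun t : Fin m.length =>
        ∑ j, (if j ∈ S ∧ g j = m.get t then (1 : R) else 0) • y j := by
    apply List.ext_getElem <;> simp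
  rw [e, h]
  refine Finset.sum_congr rfl fun φ _ => ?_
  congr 1
  rw [Finset.prod_ite_zero, Finset.prod_const_one]
  simp only [Finset.mem_univ, true_imp_iff, forall_and, Finset.image_subset_iff]
  split_ifs <;> simp_all

/-- Inclusion–exclusion over `S` keeps only the products in which every `y j` occurs. With at most
`n` factors these are the permutations, and none remain when `m` is shorter than `n`. -/
theorem sum_neg_one_pow_prod_map_sum {R B : Type*} [CommRing R] [Ring B] [Algebra R B] {n : ℕ}
    (g : Fin n → ℕ) (y : Fin n → B) (m : List ℕ) (hm : m.length ≤ n) :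
    ∑ S : Finset (Fin n), (-1 : R) ^ Sᶜ.card •
      (m.map fun k => ∑ j, (if j ∈ S ∧ g j = k then (1 : R) else 0) • y j).prod =
      ∑ σ : Equiv.Perm (Fin n), (if m = List.ofFn (fun t => g (σ t)) then (1 : R) else 0) •
        (List.ofFn fun t => y (σ t)).prod := by
  classical
  simp only [prod_map_sum_ite, Finset.smul_sum, smul_smul]
  rw [Finset.sum_comm]
  simp only [← mul_assoc, ← Finset.sum_smul, ← Finset.sum_mul, sum_powerset_neg_one_pow_card_compl]
  rcases hm.lt_or_eq with hlt | rfl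
  · rw [Finset.sum_eq_zero, Finset.sum_eq_zero]
    · intro σ _
      rw [if_neg, zero_smul]
      intro h
      have := congrArg List.length h
      simp at this
      omega
    · intro φ _
      rw [if_neg, zero_mul, zero_smul]
      intro h
      have h1 := Finset.card_image_le (s := Finset.univ) (f := φ)
      rw [h] at h1
      simp at h1
      omega
  · symm
    refine Finset.sum_of_injOn (fun σ => ⇑σ) (fun _ _ _ _ h => DFunLike.coe_injective h)
      (fun _ _ => Finset.mem_coe.2 (Finset.mem_univ _)) ?_ ?_
    · intro φ _ hφ
      rw [if_neg, zero_mul, zero_smul]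
      intro h
      have hs : Function.Surjective φ := fun j => by
        have := Finset.mem_univ j
        rw [← h] at this
        simpa using this
      exact hφ ⟨Equiv.ofBijective φ ⟨Finite.injective_iff_surjective.2 hs, hs⟩, by simp, rfl⟩
    · intro σ _
      rw [if_pos (Finset.image_univ_of_surjective σ.surjective), one_mul]
      congr 1
      refine if_congr ⟨fun h t => ?_, fun h => ?_⟩ rfl rfl
      · have := congrArg (fun z : List ℕ => z[(t : ℕ)]?) h
        simp only [List.getElem?_ofFn, t.2, dif_pos] at this
        simpa using this.symm
      · exact List.ext_getElem (by simp) fun i h1 h2 => by simpa using (h ⟨i, h1⟩).symm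

/-- Substitute for each variable the sum of those `y j` with `j ∈ S` whose position in `w` carries
it, and take the alternating sum over `S`. The coefficient at `σ` is that of `f` at the word `w`
rearranged by `σ`, hence a unit at `σ = 1`, even when `w` has repeated letters. -/
theorem HasAdmissibleIdentity.exists_multilinear {R A : Type*} [CommRing R] [NonUnitalRing A]
    [Module R A] [IsScalarTower R A A] [SMulCommClass R A A] {n : ℕ}
    (h : HasAdmissibleIdentity R A n) :
    ∃ c : Equiv.Perm (Fin n) → R, ∀ y : Fin n → A,
      (List.ofFn fun t => (y t : Unitization R A)).prod =
        ∑ σ ∈ Finset.univ.erase (1 : Equiv.Perm (Fin n)),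
          c σ • (List.ofFn fun t => (y (σ t) : Unitization R A)).prod := by
  classical
  obtain ⟨f, hdeg, ⟨w, hwn, hw⟩, hid⟩ := h
  subst hwn
  set g : Fin w.length → ℕ := fun t => (FreeMonoid.toList w).get t with hg
  set b : Equiv.Perm (Fin w.length) → R :=
    fun σ => f.coeff (FreeMonoid.ofList (List.ofFn fun t => g (σ t))) with hb
  have hb1 : IsUnit (b 1) := by
    have : FreeMonoid.ofList (List.ofFn fun t => g ((1 : Equiv.Perm (Fin w.length)) t)) = w :=
      List.ofFn_get (FreeMonoid.toList w)
    rw [hb]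
    dsimp only
    rw [this]
    exact hw
  have key : ∀ y : Fin w.length → A,
      ∑ σ, b σ • (List.ofFn fun t => (y (σ t) : Unitization R A)).prod = 0 := by
    intro y
    have h0 : ∀ S : Finset (Fin w.length), f.coeff.sum (fun m r => r •
        ((FreeMonoid.toList m).map fun k => ∑ j, (if j ∈ S ∧ g j = k then (1 : R) else 0) •
          (y j : Unitization R A)).prod) = 0 := by
      intro S
      have := hid fun k => ∑ j, (if j ∈ S ∧ g j = k then (1 : R) else 0) • y j
      rw [MonoidAlgebra.lift_apply] at this
      rw [← this]
      refine Finsupp.sum_congr fun m _ => ?_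
      rw [FreeMonoid.lift_apply]
      congr 3
      funext k
      have e := map_sum (Unitization.inrHom R R A)
        (fun j => (if j ∈ S ∧ g j = k then (1 : R) else 0) • y j) Finset.univ
      simp only [map_smul, Unitization.inrHom_apply] at e
      exact e.symm
    have h1 : ∑ S : Finset (Fin w.length), (-1 : R) ^ Sᶜ.card • f.coeff.sum (fun m r => r •
        ((FreeMonoid.toList m).map fun k => ∑ j, (if j ∈ S ∧ g j = k then (1 : R) else 0) •
          (y j : Unitization R A)).prod) = 0 :=
      Finset.sum_eq_zero fun S _ => by rw [h0 S, smul_zero]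
    simp only [Finsupp.sum, Finset.smul_sum] at h1
    rw [Finset.sum_comm] at h1
    have h2 : ∀ m ∈ f.coeff.support, ∑ S : Finset (Fin w.length), (-1 : R) ^ Sᶜ.card •
        f.coeff m • ((FreeMonoid.toList m).map fun k =>
          ∑ j, (if j ∈ S ∧ g j = k then (1 : R) else 0) • (y j : Unitization R A)).prod =
        ∑ σ : Equiv.Perm (Fin w.length),
          (if m = FreeMonoid.ofList (List.ofFn (fun t => g (σ t))) then f.coeff m else 0) •
        (List.ofFn fun t => (y (σ t) : Unitization R A)).prod := by
      intro m hm
      simp only [smul_comm _ (f.coeff m)]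
      rw [← Finset.smul_sum, sum_neg_one_pow_prod_map_sum g _ (FreeMonoid.toList m)
        (hdeg m (Finsupp.mem_support_iff.1 hm)), Finset.smul_sum]
      refine Finset.sum_congr rfl fun σ _ => ?_
      rw [smul_smul, mul_ite, mul_one, mul_zero]
      congr 1
      exact if_congr Iff.rfl rfl rfl
    rw [Finset.sum_congr rfl h2, Finset.sum_comm] at h1
    rw [← h1]
    refine Finset.sum_congr rfl fun σ _ => ?_
    rw [← Finset.sum_smul]
    congr 1
    rw [Finset.sum_ite_eq']
    split_ifs with hs
    · rfl
    · exact Finsupp.notMem_support_iff.1 hs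
  obtain ⟨v, hv⟩ := hb1
  refine ⟨fun σ => -(↑v⁻¹ * b σ), fun y => ?_⟩
  have k := key y
  rw [← Finset.add_sum_erase _ _ (Finset.mem_univ 1)] at k
  have k2 := congrArg (fun z => (↑v⁻¹ : R) • z) k
  simp only [smul_add, smul_smul, ← hv, Units.inv_mul, one_smul, smul_zero, Finset.smul_sum,
    Equiv.Perm.one_apply] at k2
  rw [eq_neg_of_add_eq_zero_left k2, ← Finset.sum_neg_distrib]
  simp only [neg_smul]

/-! ### Values of words and lexicographic descent -/

section WordValue

variable {R A ι : Type*} [CommRing R] [NonUnitalRing A] [Module R A] [IsScalarTower R A A]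
  [SMulCommClass R A A]

theorem wordValue_append (a : ι → A) (u v : List ι) :
    wordValue R a (u ++ v) = wordValue R a u * wordValue R a v := by
  simp [wordValue]

theorem wordValue_flatten (a : ι → A) (V : List (List ι)) :
    wordValue R a V.flatten = (V.map (wordValue R a)).prod := by
  induction V with
  | nil => simp [wordValue]
  | cons v V ih => rw [List.flatten_cons, wordValue_append, ih, List.map_cons, List.prod_cons]

theorem exists_inr_eq_wordValue (a : ι → A) {w : List ι} (hw : w ≠ []) :
    ∃ x : A, wordValue R a w = (x : Unitization R A) := by
  induction w with
  | nil => exact (hw rfl).elim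
  | cons i w ih =>
    rcases eq_or_ne w [] with rfl | h
    · exact ⟨a i, by simp [wordValue]⟩
    · obtain ⟨x, hx⟩ := ih h
      refine ⟨a i * x, ?_⟩
      rw [Unitization.inr_mul, ← hx]
      simp [wordValue]

theorem IsPowerProduct.wordValue_mem {Y : Set (List ι)} {h : ℕ} {w : List ι}
    (hw : IsPowerProduct Y h w) (a : ι → A) : wordValue R a w ∈ powerProducts R a Y h := by
  obtain ⟨L, hL, hY, rfl⟩ := hw
  refine ⟨L, hL, hY, ?_⟩
  rw [wordValue_flatten, List.map_map]
  congr 1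
  refine List.map_congr_left fun q _ => ?_
  simp [wordValue_flatten]

/-- An algebra with a multilinear rewriting rule: the value of a divisible word is a combination
of values of words of the same length that are lexicographically smaller. -/
theorem IsDivisible.wordValue_mem_span [LinearOrder ι] {n : ℕ} {c : Equiv.Perm (Fin n) → R}
    (hc : ∀ y : Fin n → A, (List.ofFn fun t => (y t : Unitization R A)).prod =
        ∑ σ ∈ Finset.univ.erase (1 : Equiv.Perm (Fin n)),
          c σ • (List.ofFn fun t => (y (σ t) : Unitization R A)).prod)
    (a : ι → A) {w : List ι} (hw : IsDivisible n w) :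
    wordValue R a w ∈
      Submodule.span R (wordValue R a '' {w' | w'.length = w.length ∧ w' < w}) := by
  obtain ⟨u, V, t, rfl, hne, hV, rfl⟩ := hw
  have hy : ∀ i : Fin V.length, ∃ x : A, wordValue R a V[i] = (x : Unitization R A) := fun i =>
    exists_inr_eq_wordValue a (hne _ (List.getElem_mem i.2))
  choose y hy using hy
  have hprod : ∀ σ : Equiv.Perm (Fin V.length),
      (List.ofFn fun i => (y (σ i) : Unitization R A)).prod =
        wordValue R a (List.ofFn fun i => V[σ i]).flatten := by
    intro σ
    rw [wordValue_flatten, List.map_ofFn]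
    congr 2
    funext i
    exact (hy (σ i)).symm
  have hVe : V.flatten = (List.ofFn fun i : Fin V.length => V[i]).flatten := by
    congr 1
    exact (List.ofFn_getElem (xs := V)).symm
  have h1 := hc y
  rw [show (List.ofFn fun i => (y i : Unitization R A)).prod = wordValue R a V.flatten from
    (hprod 1).trans (by rw [hVe]; rfl)] at h1
  rw [wordValue_append, wordValue_append, h1, Finset.mul_sum, Finset.sum_mul]
  refine Submodule.sum_mem _ fun σ hσ => ?_
  have hperm : (List.ofFn fun i => V[σ i]).Perm V := by
    conv_rhs => rw [← List.ofFn_getElem (xs := V)]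
    exact Equiv.Perm.ofFn_comp_perm σ fun i : Fin V.length => V[i]
  rw [mul_smul_comm, smul_mul_assoc, hprod, ← wordValue_append, ← wordValue_append]
  refine Submodule.smul_mem _ _ (Submodule.subset_span ⟨_, ⟨?_, ?_⟩, rfl⟩)
  · simp only [List.length_append, hperm.flatten.length_eq]
  · rw [List.append_assoc, List.append_assoc]
    refine List.append_left_lt (flatten_append_lt_of_perm hV hperm (fun h => ?_) t)
    refine (Finset.mem_erase.1 hσ).1 (Equiv.ext fun i => ?_)
    have hVi : V[σ i] = V[i] := by
      have := congrArg (fun z : List (List ι) => z[(i : ℕ)]?) h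
      simpa using this
    by_contra hne'
    -- The factors are strictly decreasing, hence distinct, so a nontrivial permutation really
    -- changes the list.
    have hlt : ∀ i j : Fin V.length, i < j → V[i] ≠ V[j] := fun i j hij e => by
      have := List.pairwise_iff_getElem.1 hV i j i.2 j.2 hij
      have := this [] []
      simp only [List.append_nil] at this
      exact absurd (e ▸ this : V[j] < V[j]) (lt_irrefl _)
    rcases lt_or_gt_of_ne hne' with h' | h'
    · exact hlt _ _ h' hVi
    · exact hlt _ _ h' hVi.symm

/-- A lexicographically least bad word exists because rewriting preserves the length and the
alphabet is finite; it can be neither divisible nor a power product. -/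
theorem heightAtMost_of_isDivisible_or [LinearOrder ι] [Finite ι] {n h : ℕ} {Y : Set (List ι)}
    (a : ι → A) (hA : HasAdmissibleIdentity R A n)
    (hw : ∀ w : List ι, IsDivisible n w ∨ IsPowerProduct Y h w) : HeightAtMost R a Y h := by
  obtain ⟨c, hc⟩ := hA.exists_multilinear
  intro w _
  by_contra hbad
  have hfin : {w' : List ι | w'.length = w.length ∧
      wordValue R a w' ∉ Submodule.span R (powerProducts R a Y h)}.Finite :=
    (List.finite_length_eq ι w.length).subset fun _ h => h.1
  obtain ⟨v, ⟨hvl, hv⟩, hmin⟩ := hfin.exists_minimal ⟨w, rfl, hbad⟩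
  rcases hw v with hdiv | hpow
  · refine hv (Submodule.span_le.2 ?_ (hdiv.wordValue_mem_span hc a))
    rintro _ ⟨v', ⟨hl, hlt⟩, rfl⟩
    by_contra hv'
    exact absurd hlt (not_lt_of_ge (hmin ⟨hl.trans hvl, hv'⟩ hlt.le))
  · exact hv (Submodule.subset_span (hpow.wordValue_mem a))

theorem HasAdmissibleIdentity.eq_zero (hA : HasAdmissibleIdentity R A 1) (x : A) : x = 0 := by
  obtain ⟨c, hc⟩ := hA.exists_multilinear
  have h := hc fun _ => x
  have he : Finset.univ.erase (1 : Equiv.Perm (Fin 1)) = ∅ := by decide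
  rw [he] at h
  exact Unitization.inr_injective (R := R) (by simpa using h)

theorem height_le {a : ι → A} {Y : Set (List ι)} {h : ℕ} (hh : HeightAtMost R a Y h) :
    height R a Y ≤ h :=
  sInf_le ⟨h, rfl, hh⟩

theorem inr_mem_span_wordValue {a : ι → A} (ha : NonUnitalAlgebra.adjoin R (Set.range a) = ⊤)
    (x : A) :
    (x : Unitization R A) ∈ Submodule.span R (wordValue R a '' {w | w ≠ []}) := by
  have hx : x ∈ NonUnitalAlgebra.adjoin R (Set.range a) := by simp [ha]
  induction hx using NonUnitalAlgebra.adjoin_induction with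
  | mem x hx =>
    obtain ⟨i, rfl⟩ := hx
    exact Submodule.subset_span ⟨[i], by simp, by simp [wordValue]⟩
  | add x y _ _ hx hy => rw [Unitization.inr_add]; exact Submodule.add_mem _ hx hy
  | zero => rw [Unitization.inr_zero]; exact Submodule.zero_mem _
  | smul r x _ hx => rw [Unitization.inr_smul]; exact Submodule.smul_mem _ _ hx
  | mul x y _ _ hx hy =>
    rw [Unitization.inr_mul]
    have := Submodule.mul_mem_mul hx hy
    rw [Submodule.span_mul_span] at this
    refine Submodule.span_mono ?_ this
    rintro _ ⟨_, ⟨u, hu, rfl⟩, _, ⟨v, hv, rfl⟩, rfl⟩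
    exact ⟨u ++ v, by simp_all, wordValue_append a u v⟩

theorem HeightAtMost.essentialHeight_le {a : ι → A} {Y : Set (List ι)} {h : ℕ}
    (hh : HeightAtMost R a Y h) (ha : NonUnitalAlgebra.adjoin R (Set.range a) = ⊤) :
    essentialHeight R a Y ≤ h := by
  refine sInf_le ⟨h, rfl, ∅, Set.finite_empty, fun x => ?_⟩
  refine Submodule.span_le.2 ?_ (inr_mem_span_wordValue ha x)
  rintro _ ⟨w, hw, rfl⟩
  refine Submodule.span_mono ?_ (hh w hw)
  rintro p ⟨L, hL, hY, rfl⟩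
  refine ⟨L.map fun q => wordValue R a q.1 ^ q.2, by simp; omega, ?_, ?_, rfl⟩
  · intro t ht
    obtain ⟨q, hq, rfl⟩ := List.mem_map.1 ht
    exact Or.inr ⟨q.1, (hY q hq).1, q.2, (hY q hq).2, rfl⟩
  · exact List.countP_le_length.trans (by simpa using hL)

end WordValue

/-! ### The numerical bound and the conclusion -/

theorem height_bound_lt (n l : ℕ) (hn : 2 ≤ n) :
    (3 * n + 1) * n * n * l ^ (n + 1) * (n - 1) * (n + 1) + n < 8 * (l + 1) ^ (n + 1) * n ^ 6 := by
  have hP : l ^ (n + 1) ≤ (l + 1) ^ (n + 1) := Nat.pow_le_pow_left (Nat.le_succ l) _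
  have h1 : 1 ≤ (l + 1) ^ (n + 1) := Nat.one_le_pow _ _ (Nat.succ_pos l)
  generalize (l + 1) ^ (n + 1) = P at *
  generalize l ^ (n + 1) = Q at *
  calc (3 * n + 1) * n * n * Q * (n - 1) * (n + 1) + n
      ≤ (3 * n + n) * n * n * P * n * (n + n) + n * P := by
        gcongr
        · omega
        · omega
        · omega
        · exact Nat.le_mul_of_pos_right n h1
    _ = (8 * n ^ 5 + n) * P := by ring
    _ < 8 * n ^ 6 * P := by
      refine Nat.mul_lt_mul_of_pos_right ?_ h1
      have h5 : n ≤ n ^ 5 := Nat.le_self_pow (by omega) n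
      have h6 : n ^ 5 * 2 ≤ n ^ 6 := Nat.mul_le_mul_left (n ^ 5) hn
      omega
    _ = 8 * P * n ^ 6 := by ring

theorem mainTheorem7 {R A : Type*} [CommRing R] [NonUnitalRing A] [Module R A]
    [IsScalarTower R A A] [SMulCommClass R A A]
    (n l : ℕ) (hn : 1 ≤ n)
    (a : Fin l → A) (ha : NonUnitalAlgebra.adjoin R (Set.range a) = ⊤)
    (hA : HasAdmissibleIdentity R A n) :
    height R a (shortWords (Fin l) n) < ((8 * (l + 1) ^ (n + 1) * n ^ 6 : ℕ) : ℕ∞) ∧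
    essentialHeight R a (shortWords (Fin l) n)
      < ((8 * (l + 1) ^ (n + 1) * n ^ 6 : ℕ) : ℕ∞) := by
  obtain ⟨h, hh, hlt⟩ : ∃ h, HeightAtMost R a (shortWords (Fin l) n) h ∧
      h < 8 * (l + 1) ^ (n + 1) * n ^ 6 := by
    rcases hn.eq_or_lt with rfl | hn
    -- For `n = 1` the identity forces `A = 0`, and there are no short words, so the height is `0`.
    · refine ⟨0, fun w hw => ?_, by positivity⟩
      obtain ⟨x, hx⟩ := exists_inr_eq_wordValue (R := R) a hw
      rw [hx, hA.eq_zero x, Unitization.inr_zero]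
      exact Submodule.zero_mem _
    · refine ⟨_, heightAtMost_of_isDivisible_or a hA (isDivisible_or_isPowerProduct hn), ?_⟩
      rw [Fintype.card_fin]
      exact height_bound_lt n l hn
  exact ⟨(height_le hh).trans_lt (Nat.cast_lt.2 hlt),
    (hh.essentialHeight_le ha).trans_lt (Nat.cast_lt.2 hlt)⟩
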